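/- Let $\mathbb T=\mathbb R/\mathbb Z$ with its Haar probability measure. For $f:\mathbb T\to\mathbb C$ with Fourier coefficients $a_n$, infinitely many of them nonzero, let $f_{\ge N}=\sum_{|n|\ge N}a_n e^{2\pi i n x}$ $(N\in\mathbb N)$ and $S_{f,p}(\ell)=\int_{\mathbb T}|f(x+\ell)-f(x)|^p\,dx$, and define the $p$-flatness of $f$ in the sense of high-pass filters and in the sense of structure functions by $$F_{f,p}(N)=\frac{\|f_{\ge N}\|_{L^p(\mathbb T)}^p}{\|f_{\ge N}\|_{L^2(\mathbb T)}^p},\qquad G_{f,p}(\ell)=\frac{S_{f,p}(\ell)}{S_{f,2}(\ell)^{p/2}} .$$ Write $A\asymp B$ if each of $A,B$ is eventually bounded by a constant multiple of the other in the limit considered. For $s>5/4$ let $R_s(x)=\sum_{n=1}^\infty n^{-2s}e^{2\pi i n^2x}$, which is continuous and has infinitely many nonzero Fourier coefficients. Then for every $s>5/4$ (with constants that may depend on $s$) $$G_{R_s,4}(\ell)\asymp 1\quad(\ell\to0^+),\qquad F_{R_s,4}(N)\asymp\log N\quad(N\to\infty).$$ In particular, for every sequence $\ell_N>0$ with $\ell_N\asymp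 N^{-1}$, it is not true that $F_{R_s,4}(N)\asymp G_{R_s,4}(\ell_N)$ as $N\to\infty$. Hence the two flatnesses are not equivalent in general, even for $p=4$: it is not true that $F_{f,4}(N)\asymp G_{f,4}(1/N)$ as $N\to\infty$ for all continuous $f:\mathbb T\to\mathbb C$ with infinitely many nonzero Fourier coefficients. -/

import Mathlib

open MeasureTheory Filter Topology Asymptotics

noncomputable section

/-- The function `R_s(x) = ∑_{n ≥ 1} e^{2 π i n² x} / n^{2s}` on the torus `ℝ/ℤ`
(the series converges absolutely for `s > 1/2`). -/
def riemannR (s : ℝ) (x : UnitAddCircle) : ℂ :=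
  ∑' n : ℕ, fourier (((n : ℤ) + 1) ^ 2) x / ((((n : ℝ) + 1) ^ (2 * s) : ℝ) : ℂ)

/-- The high-pass filter `f_{≥ N} = ∑_{|n| ≥ N} a_n e^{2 π i n x}`, where the `a_n` are the Fourier
coefficients of `f`. The series converges in `L²(𝕋)` for every square integrable `f`. -/
def highPass (f : UnitAddCircle → ℂ) (N : ℕ) :
    Lp ℂ 2 (AddCircle.haarAddCircle : Measure UnitAddCircle) :=
  ∑' n : {n : ℤ // (N : ℤ) ≤ |n|}, fourierCoeff f (n : ℤ) • fourierLp 2 (n : ℤ)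

/-- The structure function `S_{f,p}(ℓ) = ∫_𝕋 |f(x + ℓ) - f(x)|^p dx`. -/
def structureFunction (f : UnitAddCircle → ℂ) (p ℓ : ℝ) : ℝ :=
  ∫ x, ‖f (x + (ℓ : UnitAddCircle)) - f x‖ ^ p ∂AddCircle.haarAddCircle

/-- The `p`-flatness in the sense of high-pass filters,
`F_{f,p}(N) = ‖f_{≥ N}‖_{L^p}^p / ‖f_{≥ N}‖_{L^2}^p`. -/
def flatnessHP (f : UnitAddCircle → ℂ) (p : ℝ) (N : ℕ) : ℝ :=
  (eLpNorm (highPass f N) (ENNReal.ofReal p) AddCircle.haarAddCircle).toReal ^ p /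
    (eLpNorm (highPass f N) 2 AddCircle.haarAddCircle).toReal ^ p

/-- The `p`-flatness in the sense of structure functions,
`G_{f,p}(ℓ) = S_{f,p}(ℓ) / S_{f,2}(ℓ)^{p/2}`. -/
def flatnessSF (f : UnitAddCircle → ℂ) (p ℓ : ℝ) : ℝ :=
  structureFunction f p ℓ / structureFunction f 2 ℓ ^ (p / 2)

end

/-! Both flatnesses reduce to `L²` and `L⁴` norms of series `∑ b_n e^{2πi n² x}`. By orthogonality
the fourth power of the `L⁴` norm is a weighted count of solutions of `a² + b² = c² + d²`, and
solutions of size `X` number about `X² log X` (`card_sqQuads_le`, `le_card_sqQuads`): the diagonal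
alone would give `X²`, and the logarithm is the whole source of the discrepancy.

The high-pass filter at `N` keeps the `n ≥ M ≈ √N`. All its dyadic blocks sit at height at least
`M`, so `‖·‖₄⁴` is about `log M` times `‖·‖₂⁴`, and `F ≍ log N`.

The increment `R_s(x + ℓ) - R_s(x)` has coefficients of size at most `2πℓ n^{2-2s}`. For `s > 5/4`
the exponent `2s - 2` exceeds `1/2`, so the dyadic sum starting at `n = 1` converges in `L⁴` and
gives a norm `≲ ℓ` with no logarithm, while the single frequency `n = 1` already gives an `L²` norm
`≥ 4ℓ`. Hence `G ≍ 1`. -/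

/-! ### Upper bound for the number of solutions of `a² + b² = c² + d²`. -/

/-- The solutions of `a² + b² = c² + d²` in a finite set of natural numbers. -/
def sqQuads (S : Finset ℕ) : Finset (ℕ × ℕ × ℕ × ℕ) :=
  (S ×ˢ S ×ˢ S ×ˢ S).filter fun q => q.1 ^ 2 + q.2.1 ^ 2 = q.2.2.1 ^ 2 + q.2.2.2 ^ 2

lemma mem_sqQuads {S : Finset ℕ} {a b c d : ℕ} :
    (a, b, c, d) ∈ sqQuads S ↔
      (a ∈ S ∧ b ∈ S ∧ c ∈ S ∧ d ∈ S) ∧ a ^ 2 + b ^ 2 = c ^ 2 + d ^ 2 := by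
  simp [sqQuads]

lemma sqQuads_mono {S T : Finset ℕ} (h : S ⊆ T) : sqQuads S ⊆ sqQuads T := by
  rintro ⟨a, b, c, d⟩ hq
  rw [mem_sqQuads] at hq ⊢
  exact ⟨⟨h hq.1.1, h hq.1.2.1, h hq.1.2.2.1, h hq.1.2.2.2⟩, hq.2⟩

/-- Two factorizations of the same positive number have a common refinement. -/
lemma exists_common_refinement {A B C D : ℕ} (hA : 0 < A) (h : A * B = C * D) :
    ∃ u v w z : ℕ, A = u * v ∧ B = w * z ∧ C = u * w ∧ D = v * z := by
  obtain ⟨u, v, ⟨w, rfl⟩, ⟨z, rfl⟩, rfl⟩ :=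
    exists_dvd_and_dvd_of_dvd_mul (Dvd.intro _ h : A ∣ C * D)
  refine ⟨u, v, w, z, rfl, ?_, rfl, rfl⟩
  apply Nat.eq_of_mul_eq_mul_left hA
  rw [h]; ring

/-- By symmetry take `w ≤ v`: each `v` has at most `v` such `w`, which leaves the harmonic sum `Y² ∑
1/v`. -/
lemma sum_max_sq_le (Y : ℕ) :
    ∑ p ∈ Finset.Icc 1 Y ×ˢ Finset.Icc 1 Y, ((Y : ℝ) / (max p.1 p.2 : ℕ)) ^ 2
      ≤ 2 * (Y : ℝ) ^ 2 * (1 + Real.log Y) := by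
  have key : ∑ v ∈ Finset.Icc 1 Y, ∑ w ∈ Finset.Icc 1 Y,
      (if w ≤ v then ((Y : ℝ) / v) ^ 2 else 0) ≤ (Y : ℝ) ^ 2 * (1 + Real.log Y) := by
    have h1 : ∀ v ∈ Finset.Icc 1 Y, ∑ w ∈ Finset.Icc 1 Y,
        (if w ≤ v then ((Y : ℝ) / v) ^ 2 else 0) ≤ (Y : ℝ) ^ 2 * (v : ℝ)⁻¹ := by
      intro v hv
      rw [Finset.mem_Icc] at hv
      rw [← Finset.sum_filter, Finset.sum_const, nsmul_eq_mul]
      have hc : ((Finset.Icc 1 Y).filter (· ≤ v)).card ≤ v := by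
        calc _ ≤ (Finset.Icc 1 v).card := by
              apply Finset.card_le_card
              intro x hx
              simp only [Finset.mem_filter, Finset.mem_Icc] at hx ⊢
              omega
          _ = v := by simp
      have hv0 : (0 : ℝ) < v := by exact_mod_cast hv.1
      calc _ ≤ (v : ℝ) * ((Y : ℝ) / v) ^ 2 := by gcongr
        _ = _ := by field_simp
    refine (Finset.sum_le_sum h1).trans ?_
    rw [← Finset.mul_sum]
    gcongr
    have := harmonic_le_one_add_log Y
    rw [harmonic_eq_sum_Icc] at this
    push_cast at this
    exact this
  calc _ ≤ ∑ v ∈ Finset.Icc 1 Y, ∑ w ∈ Finset.Icc 1 Y,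
        ((if w ≤ v then ((Y : ℝ) / v) ^ 2 else 0) + (if v ≤ w then ((Y : ℝ) / w) ^ 2 else 0)) := by
        rw [Finset.sum_product]
        refine Finset.sum_le_sum fun v _ => Finset.sum_le_sum fun w _ => ?_
        rcases le_total v w with h | h
        · rw [max_eq_right h, if_pos h]
          split_ifs <;> simp [sq_nonneg]
        · rw [max_eq_left h, if_pos h]
          split_ifs <;> simp [sq_nonneg]
    _ = ∑ v ∈ Finset.Icc 1 Y, ∑ w ∈ Finset.Icc 1 Y, (if w ≤ v then ((Y : ℝ) / v) ^ 2 else 0)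
        + ∑ w ∈ Finset.Icc 1 Y, ∑ v ∈ Finset.Icc 1 Y, (if v ≤ w then ((Y : ℝ) / w) ^ 2 else 0) := by
        simp_rw [Finset.sum_add_distrib]
        congr 1
        rw [Finset.sum_comm]
    _ ≤ _ := by linarith

/-- Write the equation as `(a - c)(a + c) = (d - b)(d + b)` and refine: `a - c = uv`, `a + c = wz`,
`d - b = uw`, `d + b = vz`. All four products are at most `Y = 2X`, so `u` and `z` are at most `Y /
max v w`; summing over `v, w` gives the bound. -/
lemma card_sqQuads_lt_le (X : ℕ) :
    (((sqQuads (Finset.Icc 1 X)).filter fun q => q.2.2.1 < q.1).card : ℝ)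
      ≤ 8 * (X : ℝ) ^ 2 * (1 + Real.log (2 * X)) := by
  set Y := 2 * X with hY
  let T : Finset (Σ _ : ℕ × ℕ, ℕ × ℕ) := (Finset.Icc 1 Y ×ˢ Finset.Icc 1 Y).sigma
    fun p => Finset.Icc 1 (Y / max p.1 p.2) ×ˢ Finset.Icc 1 (Y / max p.1 p.2)
  let f : (Σ _ : ℕ × ℕ, ℕ × ℕ) → ℕ × ℕ × ℕ × ℕ := fun t =>
    ((t.2.1 * t.1.1 + t.1.2 * t.2.2) / 2, (t.1.1 * t.2.2 - t.2.1 * t.1.2) / 2,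
      (t.1.2 * t.2.2 - t.2.1 * t.1.1) / 2, (t.2.1 * t.1.2 + t.1.1 * t.2.2) / 2)
  have hsub : ((sqQuads (Finset.Icc 1 X)).filter fun q => q.2.2.1 < q.1) ⊆ T.image f := by
    rintro ⟨a, b, c, d⟩ hq
    rw [Finset.mem_filter, mem_sqQuads] at hq
    obtain ⟨⟨⟨ha, hb, hc, hd⟩, he⟩, hlt⟩ := hq
    simp only [Finset.mem_Icc] at ha hb hc hd hlt
    have hbd : b < d := by
      by_contra! h
      nlinarith
    obtain ⟨m, rfl⟩ := Nat.exists_eq_add_of_lt hlt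
    obtain ⟨n, rfl⟩ := Nat.exists_eq_add_of_lt hbd
    have hprod : (m + 1) * (2 * c + m + 1) = (n + 1) * (2 * b + n + 1) := by nlinarith
    obtain ⟨u, v, w, z, h1, h2, h3, h4⟩ := exists_common_refinement (Nat.succ_pos m) hprod
    have hu : 0 < u := Nat.pos_of_ne_zero fun h => by simp [h] at h1
    have hv : 0 < v := Nat.pos_of_ne_zero fun h => by simp [h] at h1
    have hw : 0 < w := Nat.pos_of_ne_zero fun h => by simp [h] at h3
    have hz : 0 < z := Nat.pos_of_ne_zero fun h => by simp [h] at h2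
    have hmax : ∀ x, x * v ≤ Y → x * w ≤ Y → x ≤ Y / max v w := by
      intro x h h'
      rw [Nat.le_div_iff_mul_le (by positivity)]
      rcases le_total v w with hvw | hvw <;> simp [hvw, h, h']
    rw [Finset.mem_image]
    refine ⟨⟨(v, w), (u, z)⟩, ?_, ?_⟩
    · simp only [T, Finset.mem_sigma, Finset.mem_product, Finset.mem_Icc]
      refine ⟨⟨⟨hv, ?_⟩, ⟨hw, ?_⟩⟩, ⟨hu, hmax u ?_ ?_⟩, ⟨hz, hmax z ?_ ?_⟩⟩
      · have : v ≤ u * v := Nat.le_mul_of_pos_left _ hu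
        omega
      · have : w ≤ u * w := Nat.le_mul_of_pos_left _ hu
        omega
      · omega
      · omega
      · rw [mul_comm z v]; omega
      · rw [mul_comm z w]; omega
    · simp only [f, ← h1, ← h2, ← h3, ← h4, Prod.mk.injEq]
      omega
  have hT : (T.card : ℝ) ≤ 2 * (Y : ℝ) ^ 2 * (1 + Real.log Y) := by
    refine le_trans ?_ (sum_max_sq_le Y)
    rw [Finset.card_sigma]
    rw [Nat.cast_sum]
    refine Finset.sum_le_sum fun p _ => ?_
    rw [Finset.card_product, Nat.card_Icc, Nat.add_sub_cancel, Nat.cast_mul, ← sq]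
    gcongr
    exact Nat.cast_div_le (α := ℝ)
  calc _ ≤ (T.card : ℝ) := by
        exact_mod_cast (Finset.card_le_card hsub).trans Finset.card_image_le
    _ ≤ _ := hT
    _ = _ := by rw [hY]; push_cast; ring

lemma card_sqQuads_le {X : ℕ} (hX : 1 ≤ X) :
    ((sqQuads (Finset.Icc 1 X)).card : ℝ) ≤ 33 * (X : ℝ) ^ 2 * (1 + Real.log X) := by
  set Q := sqQuads (Finset.Icc 1 X) with hQ
  have hdiag : (Q.filter fun q => q.1 = q.2.2.1).card ≤ X ^ 2 := by
    calc _ ≤ (Finset.Icc 1 X ×ˢ Finset.Icc 1 X).card := by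
          apply Finset.card_le_card_of_injOn (fun q => (q.1, q.2.1))
          · rintro ⟨a, b, c, d⟩ hq
            simp only [Finset.coe_filter, Set.mem_ofPred_eq, hQ, mem_sqQuads] at hq
            simp only [Finset.coe_product, Set.mem_prod, Finset.mem_coe]
            exact ⟨hq.1.1.1, hq.1.1.2.1⟩
          · rintro ⟨a, b, c, d⟩ hq ⟨a', b', c', d'⟩ hq' h
            simp only [Finset.coe_filter, Set.mem_ofPred_eq, hQ, mem_sqQuads] at hq hq'
            simp only [Prod.mk.injEq] at h ⊢
            obtain ⟨rfl, rfl⟩ := h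
            obtain ⟨⟨-, h1⟩, rfl⟩ := hq
            obtain ⟨⟨-, h2⟩, rfl⟩ := hq'
            refine ⟨rfl, rfl, rfl, ?_⟩
            have : d ^ 2 = d' ^ 2 := by omega
            exact Nat.pow_left_injective two_ne_zero this
      _ = X ^ 2 := by simp [sq]
  -- Exchanging the two sides of the equation exchanges `a < c` and `c < a`.
  have hswap : (Q.filter fun q => q.1 < q.2.2.1).card ≤ (Q.filter fun q => q.2.2.1 < q.1).card := by
    apply Finset.card_le_card_of_injOn (fun q => (q.2.2.1, q.2.2.2, q.1, q.2.1))
    · rintro ⟨a, b, c, d⟩ hq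
      simp only [Finset.coe_filter, Set.mem_ofPred_eq, hQ, mem_sqQuads] at hq ⊢
      exact ⟨⟨⟨hq.1.1.2.2.1, hq.1.1.2.2.2, hq.1.1.1, hq.1.1.2.1⟩, hq.1.2.symm⟩, hq.2⟩
    · rintro ⟨a, b, c, d⟩ - ⟨a', b', c', d'⟩ - h
      simp only [Prod.mk.injEq] at h ⊢
      tauto
  have hsplit : Q.card ≤ (Q.filter fun q => q.1 = q.2.2.1).card +
      ((Q.filter fun q => q.1 < q.2.2.1).card + (Q.filter fun q => q.2.2.1 < q.1).card) := by
    refine le_trans (Finset.card_le_card ?_) ((Finset.card_union_le _ _).trans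
      (Nat.add_le_add_left (Finset.card_union_le _ _) _))
    intro q hq
    simp only [Finset.mem_union, Finset.mem_filter, hq, true_and]
    omega
  have hlt := card_sqQuads_lt_le X
  have hX0 : (1 : ℝ) ≤ X := by exact_mod_cast hX
  have hlog : Real.log (2 * X) ≤ 1 + Real.log X := by
    rw [Real.log_mul (by norm_num) (by positivity)]
    linarith [Real.log_two_lt_d9]
  have hl0 : 0 ≤ Real.log X := Real.log_nonneg hX0
  have h1 : (Q.card : ℝ) ≤ (X : ℝ) ^ 2 + 2 * (8 * (X : ℝ) ^ 2 * (1 + Real.log (2 * X))) := by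
    have : (Q.card : ℝ) ≤ (X : ℝ) ^ 2 + 2 * ((Q.filter fun q => q.2.2.1 < q.1).card : ℝ) := by
      exact_mod_cast (by omega : Q.card ≤ X ^ 2 + 2 * (Q.filter fun q => q.2.2.1 < q.1).card)
    linarith
  have : (X : ℝ) ^ 2 * Real.log (2 * X) ≤ (X : ℝ) ^ 2 * (1 + Real.log X) := by gcongr
  have h3 : 0 ≤ (X : ℝ) ^ 2 * Real.log X := by positivity
  nlinarith

/-! ### Lower bound for the number of solutions, with all variables of comparable size. -/

lemma sum_inv_sq_Icc_le_two (X : ℕ) : ∑ k ∈ Finset.Icc 1 X, ((k : ℝ) ^ 2)⁻¹ ≤ 2 := by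
  rcases Nat.eq_zero_or_pos X with rfl | hX
  · simp
  · have h := sum_Ioc_inv_sq_le_sub (α := ℝ) one_ne_zero hX
    rw [← Finset.add_sum_Ioc_eq_sum_Icc (by omega)]
    have : (0 : ℝ) ≤ (X : ℝ)⁻¹ := by positivity
    norm_num at h ⊢
    linarith

/-- Insert `n = ∑_{d ∣ n} φ(d)` into `∑ 1/n = ∑ n/n²`, exchange the sums and write `n = dk`; the sum
over `k` is at most `∑ 1/k² ≤ 2`. -/
lemma log_le_two_mul_sum_totient (X : ℕ) :
    Real.log (X + 1) ≤ 2 * ∑ d ∈ Finset.Icc 1 X, (d.totient : ℝ) / (d : ℝ) ^ 2 := by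
  have h1 : Real.log (X + 1) ≤ ∑ n ∈ Finset.Icc 1 X, ((n : ℝ))⁻¹ := by
    have := log_add_one_le_harmonic X
    rw [harmonic_eq_sum_Icc] at this
    push_cast at this
    exact this
  have h2 : ∑ n ∈ Finset.Icc 1 X, ((n : ℝ))⁻¹ =
      ∑ n ∈ Finset.Icc 1 X, ∑ d ∈ n.divisors, (d.totient : ℝ) * ((n : ℝ) ^ 2)⁻¹ := by
    refine Finset.sum_congr rfl fun n hn => ?_
    rw [Finset.mem_Icc] at hn
    have hn0 : (n : ℝ) ≠ 0 := by exact_mod_cast (by omega : n ≠ 0)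
    rw [← Finset.sum_mul, ← Nat.cast_sum, Nat.sum_totient]
    field_simp
  have h3 : ∑ n ∈ Finset.Icc 1 X, ∑ d ∈ n.divisors, (d.totient : ℝ) * ((n : ℝ) ^ 2)⁻¹ =
      ∑ d ∈ Finset.Icc 1 X, ∑ n ∈ (Finset.Icc 1 X).filter (d ∣ ·),
        (d.totient : ℝ) * ((n : ℝ) ^ 2)⁻¹ := by
    apply Finset.sum_comm'
    intro n d
    simp only [Finset.mem_Icc, Nat.mem_divisors, Finset.mem_filter]
    constructor
    · rintro ⟨⟨h1, h2⟩, h3, -⟩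
      exact ⟨⟨⟨h1, h2⟩, h3⟩, Nat.pos_of_dvd_of_pos h3 h1, (Nat.le_of_dvd h1 h3).trans h2⟩
    · rintro ⟨⟨⟨h1, h2⟩, h3⟩, -⟩
      exact ⟨⟨h1, h2⟩, h3, by omega⟩
  rw [h2, h3] at h1
  refine h1.trans ?_
  rw [Finset.mul_sum]
  refine Finset.sum_le_sum fun d hd => ?_
  rw [Finset.mem_Icc] at hd
  rw [← Finset.mul_sum]
  have h4 : ∑ n ∈ (Finset.Icc 1 X).filter (d ∣ ·), ((n : ℝ) ^ 2)⁻¹ ≤ 2 * ((d : ℝ) ^ 2)⁻¹ := by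
    calc _ ≤ ∑ n ∈ (Finset.Icc 1 X).image (d * ·), ((n : ℝ) ^ 2)⁻¹ := by
          apply Finset.sum_le_sum_of_subset_of_nonneg
          · intro n hn
            simp only [Finset.mem_filter, Finset.mem_Icc, Finset.mem_image] at hn ⊢
            obtain ⟨⟨h5, h6⟩, k, rfl⟩ := hn
            exact ⟨k, ⟨Nat.pos_of_mul_pos_left h5, (Nat.le_mul_of_pos_left _ hd.1).trans h6⟩, rfl⟩
          · intros; positivity
      _ = ∑ k ∈ Finset.Icc 1 X, ((d : ℝ) ^ 2)⁻¹ * ((k : ℝ) ^ 2)⁻¹ := by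
          rw [Finset.sum_image fun x _ y _ h => Nat.eq_of_mul_eq_mul_left hd.1 h]
          refine Finset.sum_congr rfl fun k _ => ?_
          push_cast
          rw [mul_pow, mul_inv]
      _ ≤ _ := by
          rw [← Finset.mul_sum, mul_comm]
          gcongr
          exact sum_inv_sq_Icc_le_two X
  calc _ ≤ (d.totient : ℝ) * (2 * ((d : ℝ) ^ 2)⁻¹) := by gcongr
    _ = _ := by ring

lemma div_two_le_natCast_div {m n : ℕ} (hn : 0 < n) (h : n ≤ m) :
    (m : ℝ) / (2 * n) ≤ (m / n : ℕ) := by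
  have h1 : 1 ≤ m / n := (Nat.one_le_div_iff hn).2 h
  have h2 : m < n * (m / n + 1) := Nat.lt_mul_div_succ m hn
  have h3 : (m : ℝ) < n * ((m / n : ℕ) + 1) := by exact_mod_cast h2
  have h4 : (1 : ℝ) ≤ (m / n : ℕ) := by exact_mod_cast h1
  have hn0 : (0 : ℝ) < n := by exact_mod_cast hn
  rw [div_le_iff₀ (by positivity)]
  nlinarith

lemma le_card_sqQuads {M : ℕ} (hM : 1 ≤ M) :
    (M : ℝ) ^ 2 * Real.log M / 32 ≤ ((sqQuads (Finset.Icc M (9 * M))).card : ℝ) := by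
  -- The parametrization by `u, v, w, z` again, doubled to avoid parity conditions. Coprimality of
  -- `v` and `w` makes it injective, and `v ∈ [w, 2w)` leaves exactly `φ(w)` choices. The ranges
  -- force `uw ≤ M/2`, `uv ≤ M`, `2M < wz ≤ 3M` and `vz ≤ 6M`, so all four entries lie in `[M, 9M]`.
  let T : Finset (Σ _ : ℕ, ℕ × ℕ × ℕ) := (Finset.Icc 1 (M / 2)).sigma fun w =>
    ((Finset.Ico w (w + w)).filter w.Coprime) ×ˢ
      Finset.Icc 1 (M / (2 * w)) ×ˢ Finset.Icc (2 * M / w + 1) (2 * M / w + M / w)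
  let f : (Σ _ : ℕ, ℕ × ℕ × ℕ) → ℕ × ℕ × ℕ × ℕ := fun t =>
    (t.2.2.1 * t.2.1 + t.1 * t.2.2.2, t.2.1 * t.2.2.2 - t.2.2.1 * t.1,
      t.1 * t.2.2.2 - t.2.2.1 * t.2.1, t.2.2.1 * t.1 + t.2.1 * t.2.2.2)
  have hmem : ∀ w v u z, (⟨w, v, u, z⟩ : Σ _ : ℕ, ℕ × ℕ × ℕ) ∈ T → 0 < w ∧ w ≤ v ∧
      w.Coprime v ∧ 0 < u ∧ 2 * (u * w) ≤ M ∧ u * v ≤ M ∧ u * w ≤ u * v ∧ 2 * M < w * z ∧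
      w * z ≤ 3 * M ∧ w * z ≤ v * z ∧ v * z ≤ 6 * M := by
    intro w v u z h
    simp only [T, Finset.mem_sigma, Finset.mem_product, Finset.mem_filter, Finset.mem_Icc,
      Finset.mem_Ico] at h
    obtain ⟨⟨hw, -⟩, ⟨⟨hv, hv'⟩, hcop⟩, ⟨hu, hu'⟩, hz, hz'⟩ := h
    rw [Nat.le_div_iff_mul_le (by positivity)] at hu'
    have h1 : 2 * (u * w) ≤ M := by linarith
    have h2 : u * v ≤ u * (2 * w) := Nat.mul_le_mul_left _ (by omega)
    have h3 : u * w ≤ u * v := Nat.mul_le_mul_left _ hv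
    have h4 : 2 * M < w * z :=
      (Nat.lt_mul_div_succ (2 * M) hw).trans_le (Nat.mul_le_mul_left _ hz)
    have h5 : w * z ≤ 3 * M := by
      have h6 := Nat.mul_div_le (2 * M) w
      have h7 := Nat.mul_div_le M w
      have h8 : w * z ≤ w * (2 * M / w + M / w) := Nat.mul_le_mul_left _ hz'
      linarith
    have h9 : w * z ≤ v * z := Nat.mul_le_mul_right _ hv
    have h10 : v * z ≤ (2 * w) * z := Nat.mul_le_mul_right _ (by omega)
    exact ⟨hw, hv, hcop, hu, h1, by linarith, h3, h4, h5, h9, by linarith⟩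
  have hcard : T.card ≤ (sqQuads (Finset.Icc M (9 * M))).card := by
    apply Finset.card_le_card_of_injOn f
    · rintro ⟨w, v, u, z⟩ ht
      obtain ⟨hw, hv, hcop, hu, h1, h2, h3, h4, h5, h6, h7⟩ := hmem w v u z ht
      simp only [f, Finset.mem_coe, mem_sqQuads, Finset.mem_Icc]
      refine ⟨by omega, ?_⟩
      obtain ⟨p, hp⟩ := Nat.exists_eq_add_of_le (show u * v ≤ w * z by omega)
      obtain ⟨q, hq⟩ := Nat.exists_eq_add_of_le (show u * w ≤ v * z by omega)
      rw [hp, hq, Nat.add_sub_cancel_left, Nat.add_sub_cancel_left]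
      have : (u * v) * (u * v + p) = (u * w) * (u * w + q) := by rw [← hp, ← hq]; ring
      nlinarith
    · rintro ⟨w, v, u, z⟩ ht ⟨w', v', u', z'⟩ ht' h
      obtain ⟨hw, hv, hcop, hu, h1, h2, h3, h4, h5, h6, h7⟩ := hmem w v u z ht
      obtain ⟨hw', hv', hcop', hu', h1', h2', h3', h4', h5', h6', h7'⟩ := hmem w' v' u' z' ht'
      simp only [f, Prod.mk.injEq] at h
      have e1 : u * v = u' * v' := by omega
      have e2 : w * z = w' * z' := by omega
      have e3 : u * w = u' * w' := by omega
      -- The products `uv`, `uw` determine the ratio `v/w`, which is in lowest terms.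
      have e4 : v * w' = v' * w := by
        have : (u * u') * (v * w') = (u * u') * (v' * w) := by
          calc _ = (u * v) * (u' * w') := by ring
            _ = (u' * v') * (u * w) := by rw [e1, e3]
            _ = _ := by ring
        exact Nat.eq_of_mul_eq_mul_left (by positivity) this
      have e5 : w = w' := by
        apply Nat.dvd_antisymm
        · exact hcop.dvd_of_dvd_mul_left (Dvd.intro_left _ e4.symm)
        · exact hcop'.dvd_of_dvd_mul_left (Dvd.intro_left _ e4)
      subst e5
      have e6 : u = u' := Nat.eq_of_mul_eq_mul_right hw e3
      subst e6
      rw [Nat.eq_of_mul_eq_mul_left hu e1, Nat.eq_of_mul_eq_mul_left hw e2]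
  have hTcard : (T.card : ℝ) = ∑ w ∈ Finset.Icc 1 (M / 2),
      (w.totient : ℝ) * ((M / (2 * w) : ℕ) * (M / w : ℕ)) := by
    simp only [T, Finset.card_sigma, Finset.card_product, Nat.card_Icc,
      Nat.filter_coprime_Ico_eq_totient, Nat.cast_sum, Nat.cast_mul]
    refine Finset.sum_congr rfl fun w _ => ?_
    rw [show 2 * M / w + M / w + 1 - (2 * M / w + 1) = M / w by
      generalize 2 * M / w = x; generalize M / w = y; omega, Nat.add_sub_cancel]
  have hsum : (M : ℝ) ^ 2 / 8 * ∑ w ∈ Finset.Icc 1 (M / 2), (w.totient : ℝ) / (w : ℝ) ^ 2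
      ≤ (T.card : ℝ) := by
    rw [hTcard, Finset.mul_sum]
    refine Finset.sum_le_sum fun w hw => ?_
    rw [Finset.mem_Icc] at hw
    have hw0 : (0 : ℝ) < w := by exact_mod_cast hw.1
    have h1 := div_two_le_natCast_div (m := M) (n := 2 * w) (by omega) (by omega)
    have h2 := div_two_le_natCast_div (m := M) (n := w) (by omega) (by omega)
    push_cast at h1
    calc (M : ℝ) ^ 2 / 8 * ((w.totient : ℝ) / (w : ℝ) ^ 2)
        = (w.totient : ℝ) * ((M : ℝ) / (2 * (2 * w)) * ((M : ℝ) / (2 * w))) := by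
          field_simp; ring
      _ ≤ _ := by gcongr
  have hlog := log_le_two_mul_sum_totient (M / 2)
  have hM0 : (1 : ℝ) ≤ M := by exact_mod_cast hM
  have hlog2 : Real.log M ≤ 2 * Real.log ((M / 2 : ℕ) + 1) := by
    rw [← Nat.cast_ofNat (R := ℝ) (n := 2), ← Real.log_pow]
    apply Real.log_le_log (by positivity)
    have h1 : M ≤ 2 * (M / 2) + 1 := by omega
    exact_mod_cast (by nlinarith : M ≤ (M / 2 + 1) ^ 2)
  have hfin : (T.card : ℝ) ≤ ((sqQuads (Finset.Icc M (9 * M))).card : ℝ) := by exact_mod_cast hcard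
  have : (M : ℝ) ^ 2 / 8 * (Real.log M / 4) ≤
      (M : ℝ) ^ 2 / 8 * ∑ w ∈ Finset.Icc 1 (M / 2), (w.totient : ℝ) / (w : ℝ) ^ 2 := by
    gcongr
    linarith
  linarith

/-! ### `L²` and `L⁴` norms of trigonometric sums over squares. -/

instance fact_one_le_four_ennreal : Fact ((1 : ENNReal) ≤ 4) := ⟨by norm_num⟩

/-- The term `b_n e^{2 π i n² x}` as a continuous function on the circle. -/
noncomputable def quadTerm (b : ℕ → ℂ) (n : ℕ) : C(UnitAddCircle, ℂ) := b n • fourier ((n : ℤ) ^ 2)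

lemma quadTerm_apply (b : ℕ → ℂ) (n : ℕ) (x : UnitAddCircle) :
    quadTerm b n x = b n * fourier ((n : ℤ) ^ 2) x := rfl

lemma norm_quadTerm (b : ℕ → ℂ) (n : ℕ) : ‖quadTerm b n‖ = ‖b n‖ := by
  rw [quadTerm, norm_smul, fourier_norm, mul_one]

/-- The norm of a continuous function on the circle in `L^p`. -/
noncomputable def normLp (p : ENNReal) [Fact (1 ≤ p)] (F : C(UnitAddCircle, ℂ)) : ℝ :=
  ‖ContinuousMap.toLp p AddCircle.haarAddCircle ℂ F‖

section normLp

variable (p : ENNReal) [Fact (1 ≤ p)]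

lemma normLp_nonneg (F : C(UnitAddCircle, ℂ)) : 0 ≤ normLp p F := norm_nonneg _

lemma normLp_eq_toReal_eLpNorm (F : C(UnitAddCircle, ℂ)) :
    normLp p F = (eLpNorm F p AddCircle.haarAddCircle).toReal := by
  rw [normLp, Lp.norm_def, eLpNorm_congr_ae (ContinuousMap.coeFn_toLp _ F)]

lemma normLp_pow_eq_integral (k : ℕ) (hk : k ≠ 0) (hp : p = k) (F : C(UnitAddCircle, ℂ)) :
    normLp p F ^ k = ∫ x, ‖F x‖ ^ k ∂AddCircle.haarAddCircle := by
  subst hp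
  have hF : MemLp F (k : ENNReal) (AddCircle.haarAddCircle (T := 1)) :=
    F.continuous.memLp_of_hasCompactSupport (HasCompactSupport.of_compactSpace F)
  rw [normLp_eq_toReal_eLpNorm, hF.eLpNorm_eq_integral_rpow_norm (by simpa using hk)
    (ENNReal.natCast_ne_top k)]
  simp only [ENNReal.toReal_natCast, Real.rpow_natCast]
  have h0 : 0 ≤ ∫ x, ‖F x‖ ^ k ∂(AddCircle.haarAddCircle (T := 1)) :=
    integral_nonneg fun x => by positivity
  rw [ENNReal.toReal_ofReal (by positivity), Real.rpow_inv_natCast_pow h0 hk]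

lemma tendsto_normLp_sum {b : ℕ → ℂ} (hb : Summable fun n => ‖b n‖) :
    Tendsto (fun K => normLp p (∑ n ∈ Finset.range K, quadTerm b n)) atTop
      (𝓝 (normLp p (∑' n, quadTerm b n))) := by
  have hs : Summable (quadTerm b) := Summable.of_norm (by simpa only [norm_quadTerm] using hb)
  exact ((ContinuousLinearMap.continuous _).norm.tendsto _).comp hs.hasSum.tendsto_sum_nat

end normLp

lemma normLp_two_le_four (F : C(UnitAddCircle, ℂ)) : normLp 2 F ≤ normLp 4 F := by
  have hF : MemLp F 4 (AddCircle.haarAddCircle (T := 1)) :=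
    F.continuous.memLp_of_hasCompactSupport (HasCompactSupport.of_compactSpace F)
  rw [normLp_eq_toReal_eLpNorm, normLp_eq_toReal_eLpNorm]
  exact ENNReal.toReal_mono hF.2.ne
    (eLpNorm_le_eLpNorm_of_exponent_le (by norm_num) hF.1)

lemma natCast_sq_injective : Function.Injective fun n : ℕ => (n : ℤ) ^ 2 := by
  intro m n h
  dsimp only at h
  exact Nat.pow_left_injective two_ne_zero (by exact_mod_cast h : m ^ 2 = n ^ 2)

lemma normLp_two_sq_sum (b : ℕ → ℂ) (S : Finset ℕ) :
    normLp 2 (∑ n ∈ S, quadTerm b n) ^ 2 = ∑ n ∈ S, ‖b n‖ ^ 2 := by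
  have ho := (orthonormal_fourier (T := 1)).comp _ natCast_sq_injective
  have h : ContinuousMap.toLp 2 AddCircle.haarAddCircle ℂ (∑ n ∈ S, quadTerm b n)
      = ∑ n ∈ S, b n • fourierLp (T := 1) 2 ((n : ℤ) ^ 2) := by
    rw [map_sum]
    exact Finset.sum_congr rfl fun n _ => by rw [quadTerm, map_smul]
  rw [normLp, h, ← Complex.ofReal_inj, Complex.ofReal_pow,
    ← RCLike.ofReal_eq_complex_ofReal, ← inner_self_eq_norm_sq_to_K (𝕜 := ℂ)]
  refine (ho.inner_sum b b S).trans ?_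
  push_cast
  exact Finset.sum_congr rfl fun n _ => Complex.conj_mul' _

lemma integral_fourier (m : ℤ) :
    ∫ x : UnitAddCircle, fourier m x ∂AddCircle.haarAddCircle = if m = 0 then 1 else 0 := by
  have h := congrFun (fourierCoeff_fourier (T := 1) m) 0
  simp only [fourierCoeff, neg_zero, fourier_zero, one_smul, Pi.single_apply] at h
  rw [h]
  simp [eq_comm]

/-- Expand `|F|⁴ = F F F̄ F̄` and integrate: only terms of total frequency zero survive. -/
lemma normLp_four_pow_sum (b : ℕ → ℂ) (S : Finset ℕ) :
    ((normLp 4 (∑ n ∈ S, quadTerm b n) ^ 4 : ℝ) : ℂ) = ∑ q ∈ sqQuads S,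
      b q.1 * b q.2.1 * (starRingEnd ℂ (b q.2.2.1) * starRingEnd ℂ (b q.2.2.2)) := by
  have hpt : ∀ x : UnitAddCircle, ((‖(∑ n ∈ S, quadTerm b n) x‖ ^ 4 : ℝ) : ℂ) =
      ∑ q ∈ S ×ˢ S ×ˢ S ×ˢ S,
        b q.1 * b q.2.1 * (starRingEnd ℂ (b q.2.2.1) * starRingEnd ℂ (b q.2.2.2)) *
          fourier ((q.1 : ℤ) ^ 2 + (q.2.1 : ℤ) ^ 2 + (-(q.2.2.1 : ℤ) ^ 2 + -(q.2.2.2 : ℤ) ^ 2)) x := by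
    intro x
    have h1 : ∀ z : ℂ, ((‖z‖ ^ 4 : ℝ) : ℂ) = z * (z * (starRingEnd ℂ z * starRingEnd ℂ z)) := by
      intro z
      have := Complex.mul_conj' z
      push_cast
      calc (‖z‖ : ℂ) ^ 4 = ((‖z‖ : ℂ) ^ 2) * ((‖z‖ : ℂ) ^ 2) := by ring
        _ = _ := by rw [← this]; ring
    rw [h1, ContinuousMap.coe_sum, Finset.sum_apply, map_sum]
    simp only [Finset.sum_mul_sum, ← Finset.sum_product']
    simp only [Finset.sum_product]
    refine Finset.sum_congr rfl fun a _ => Finset.sum_congr rfl fun c _ =>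
      Finset.sum_congr rfl fun d _ => Finset.sum_congr rfl fun e _ => ?_
    simp only [quadTerm_apply, fourier_add, fourier_neg, map_mul]
    ring
  rw [normLp_pow_eq_integral 4 4 (by norm_num) (by norm_num), ← integral_complex_ofReal]
  simp_rw [hpt]
  rw [integral_finsetSum]
  · rw [sqQuads, Finset.sum_filter]
    refine Finset.sum_congr rfl fun q _ => ?_
    rw [integral_const_mul, integral_fourier, mul_ite, mul_one, mul_zero]
    congr 1
    rw [eq_iff_iff, ← @Nat.cast_inj ℤ]
    push_cast
    constructor <;> intro h <;> linarith
  · intro q _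
    exact Integrable.const_mul ((map_continuous _).integrable_of_hasCompactSupport
      (HasCompactSupport.of_compactSpace _)) _

lemma normLp_four_pow_sum_le {b : ℕ → ℂ} {S : Finset ℕ} {A : ℝ} (hb : ∀ n ∈ S, ‖b n‖ ≤ A) :
    normLp 4 (∑ n ∈ S, quadTerm b n) ^ 4 ≤ A ^ 4 * (sqQuads S).card := by
  have h0 : 0 ≤ normLp 4 (∑ n ∈ S, quadTerm b n) ^ 4 := by
    have := normLp_nonneg 4 (∑ n ∈ S, quadTerm b n)
    positivity
  rw [← Real.norm_of_nonneg h0, ← Complex.norm_real, normLp_four_pow_sum, mul_comm (A ^ 4),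
    ← nsmul_eq_mul]
  rw [← Finset.sum_const]
  refine norm_sum_le_of_le _ ?_
  rintro ⟨a, c, d, e⟩ hq
  rw [mem_sqQuads] at hq
  simp only [norm_mul, RCLike.norm_conj]
  have h1 := hb a hq.1.1
  have h2 := hb c hq.1.2.1
  have h3 := hb d hq.1.2.2.1
  have h4 := hb e hq.1.2.2.2
  have hA : 0 ≤ A := (norm_nonneg _).trans h1
  calc ‖b a‖ * ‖b c‖ * (‖b d‖ * ‖b e‖) ≤ A * A * (A * A) := by gcongr
    _ = A ^ 4 := by ring

/-- Nonnegative coefficients make every term of the expansion nonnegative, so restricting to `T`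
only lowers the sum. -/
lemma le_normLp_four_pow_sum {c : ℕ → ℝ} {S T : Finset ℕ} {A : ℝ} (hA : 0 ≤ A)
    (hc : ∀ n ∈ S, 0 ≤ c n) (hTS : T ⊆ S) (hT : ∀ n ∈ T, A ≤ c n) :
    A ^ 4 * (sqQuads T).card ≤ normLp 4 (∑ n ∈ S, quadTerm (fun n => (c n : ℂ)) n) ^ 4 := by
  have h : normLp 4 (∑ n ∈ S, quadTerm (fun n => (c n : ℂ)) n) ^ 4 =
      ∑ q ∈ sqQuads S, c q.1 * c q.2.1 * (c q.2.2.1 * c q.2.2.2) := by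
    rw [← Complex.ofReal_inj, normLp_four_pow_sum]
    simp
  rw [h, mul_comm (A ^ 4), ← nsmul_eq_mul, ← Finset.sum_const]
  refine le_trans (Finset.sum_le_sum ?_)
    (Finset.sum_le_sum_of_subset_of_nonneg (sqQuads_mono hTS) ?_)
  · rintro ⟨a, b, d, e⟩ hq
    rw [mem_sqQuads] at hq
    have h1 := hT a hq.1.1
    have h2 := hT b hq.1.2.1
    have h3 := hT d hq.1.2.2.1
    have h4 := hT e hq.1.2.2.2
    calc A ^ 4 = A * A * (A * A) := by ring
      _ ≤ _ := mul_le_mul (mul_le_mul h1 h2 hA (hA.trans h1)) (mul_le_mul h3 h4 hA (hA.trans h3))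
        (mul_nonneg hA hA) (mul_nonneg (hA.trans h1) (hA.trans h2))
  · rintro ⟨a, b, d, e⟩ hq -
    rw [mem_sqQuads] at hq
    have h1 := hc a hq.1.1
    have h2 := hc b hq.1.2.1
    have h3 := hc d hq.1.2.2.1
    have h4 := hc e hq.1.2.2.2
    positivity

/-! ### Upper bounds for infinite series by dyadic decomposition. -/

/-- The block at `2^j M` contributes `2^{-βj}` relative to the first, and this geometric decay
absorbs the factor `j + 2`, which leaves room for the logarithm in the `L⁴` count. -/
lemma exists_norm_sum_le_of_dyadic_blocks (E : Type*) [SeminormedAddCommGroup E] {β : ℝ}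
    (hβ : 0 < β) : ∃ C : ℝ, 0 < C ∧ ∀ (v : ℕ → E) (M : ℕ) (B : ℝ), 0 ≤ B → (∀ n < M, v n = 0) →
      (∀ j : ℕ, ‖∑ n ∈ Finset.Ico (2 ^ j * M) (2 * (2 ^ j * M)), v n‖ ≤
        B * (j + 2) * ((2 ^ j * M : ℕ) : ℝ) ^ (-β)) →
      ∀ K : ℕ, ‖∑ n ∈ Finset.range (2 ^ K * M), v n‖ ≤ C * B * (M : ℝ) ^ (-β) := by
  set r : ℝ := (2 : ℝ) ^ (-β) with hr
  have hr0 : 0 < r := by positivity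
  have hr1 : r < 1 := Real.rpow_lt_one_of_one_lt_of_neg (by norm_num) (by linarith)
  have hs : Summable fun j : ℕ => ((j : ℝ) + 2) * r ^ j := by
    have h1 := summable_pow_mul_geometric_of_norm_lt_one 1 (r := r)
      (by rwa [Real.norm_of_nonneg hr0.le])
    have h2 := (summable_geometric_of_lt_one hr0.le hr1).mul_left 2
    refine (h1.add h2).congr fun j => ?_
    ring
  refine ⟨∑' j : ℕ, ((j : ℝ) + 2) * r ^ j, hs.tsum_pos (fun j => by positivity) 0 (by simp),
    fun v M B hB hv hblock K => ?_⟩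
  have h1 : ‖∑ n ∈ Finset.range (2 ^ K * M), v n‖ ≤
      ∑ j ∈ Finset.range K, B * (j + 2) * ((2 ^ j * M : ℕ) : ℝ) ^ (-β) := by
    induction K with
    | zero =>
      rw [Finset.sum_eq_zero fun n hn => hv n (by simpa using hn)]
      simp
    | succ K ih =>
      rw [Finset.sum_range_succ, pow_succ', mul_assoc,
        ← Finset.sum_range_add_sum_Ico _ (by omega : 2 ^ K * M ≤ 2 * (2 ^ K * M))]
      exact (norm_add_le _ _).trans (add_le_add ih (hblock K))
  refine h1.trans ?_
  have h2 : ∀ j : ℕ, B * (j + 2) * ((2 ^ j * M : ℕ) : ℝ) ^ (-β) =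
      (B * (M : ℝ) ^ (-β)) * ((j + 2) * r ^ j) := by
    intro j
    push_cast
    rw [Real.mul_rpow (by positivity) (by positivity), ← Real.rpow_natCast, ← Real.rpow_mul
      (by norm_num), mul_comm (j : ℝ) (-β), Real.rpow_mul (by norm_num), Real.rpow_natCast]
    ring
  simp_rw [h2]
  rw [← Finset.mul_sum, mul_comm, mul_assoc]
  gcongr
  exact hs.sum_le_tsum _ fun j _ => by positivity

lemma normLp_tsum_le_of_range_le {p : ENNReal} [Fact (1 ≤ p)] {b : ℕ → ℂ} {M : ℕ} (hM : 1 ≤ M)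
    (hb : Summable fun n => ‖b n‖) {D : ℝ}
    (h : ∀ K : ℕ, ‖∑ n ∈ Finset.range (2 ^ K * M),
      ContinuousMap.toLp p AddCircle.haarAddCircle ℂ (quadTerm b n)‖ ≤ D) :
    normLp p (∑' n, quadTerm b n) ≤ D := by
  have hlim : Tendsto (fun K : ℕ => 2 ^ K * M) atTop atTop :=
    (tendsto_pow_atTop_atTop_of_one_lt one_lt_two).atTop_mul_const' hM
  refine le_of_tendsto' ((tendsto_normLp_sum p hb).comp hlim) fun K => ?_
  simp only [Function.comp_apply, normLp, map_sum]
  exact h K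

lemma norm_coeff_le_of_mem_block {b : ℕ → ℂ} {A α : ℝ} (hα : 0 ≤ α) (hA : 0 ≤ A) {Y : ℕ}
    (hY : 1 ≤ Y) (hb : ∀ n : ℕ, 1 ≤ n → ‖b n‖ ≤ A * (n : ℝ) ^ (-α)) :
    ∀ n ∈ Finset.Ico Y (2 * Y), ‖b n‖ ≤ A * (Y : ℝ) ^ (-α) := by
  intro n hn
  rw [Finset.mem_Ico] at hn
  refine (hb n (by omega)).trans ?_
  gcongr A * ?_
  exact Real.rpow_le_rpow_of_nonpos (by exact_mod_cast hY) (by exact_mod_cast hn.1) (by linarith)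

lemma exists_normLp_two_le {α : ℝ} (hα : 1 / 2 < α) : ∃ C : ℝ, 0 < C ∧
    ∀ (b : ℕ → ℂ) (A : ℝ) (M : ℕ), 0 ≤ A → 1 ≤ M → (∀ n < M, b n = 0) →
      (∀ n : ℕ, 1 ≤ n → ‖b n‖ ≤ A * (n : ℝ) ^ (-α)) → (Summable fun n => ‖b n‖) →
      normLp 2 (∑' n, quadTerm b n) ≤ C * A * (M : ℝ) ^ (1 / 2 - α) := by
  obtain ⟨C, hC, h⟩ := exists_norm_sum_le_of_dyadic_blocks
    (Lp ℂ 2 (AddCircle.haarAddCircle : Measure UnitAddCircle)) (β := α - 1 / 2) (by linarith)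
  refine ⟨C, hC, fun b A M hA hM hb0 hb hs => normLp_tsum_le_of_range_le hM hs fun K => ?_⟩
  rw [← neg_sub α]
  refine h _ M A hA (fun n hn => by simp [quadTerm, hb0 n hn]) (fun j => ?_) K
  set Y := 2 ^ j * M with hY
  have hY1 : 1 ≤ Y := Nat.one_le_iff_ne_zero.2 (by positivity)
  have hY0 : (0 : ℝ) < Y := by exact_mod_cast hY1
  rw [← map_sum]
  change normLp 2 _ ≤ _
  have hbd : normLp 2 (∑ n ∈ Finset.Ico Y (2 * Y), quadTerm b n) ≤
      A * (Y : ℝ) ^ (-(α - 1 / 2)) := by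
    rw [← pow_le_pow_iff_left₀ (normLp_nonneg _ _) (by positivity) two_ne_zero,
      normLp_two_sq_sum]
    have hpt := norm_coeff_le_of_mem_block (by linarith) hA hY1 hb
    calc ∑ n ∈ Finset.Ico Y (2 * Y), ‖b n‖ ^ 2
        ≤ ∑ n ∈ Finset.Ico Y (2 * Y), (A * (Y : ℝ) ^ (-α)) ^ 2 := by
          refine Finset.sum_le_sum fun n hn => ?_
          have := hpt n hn
          gcongr
      _ = A ^ 2 * ((Y : ℝ) * ((Y : ℝ) ^ (-α)) ^ 2) := by
          rw [Finset.sum_const, Nat.card_Ico, nsmul_eq_mul, show 2 * Y - Y = Y by omega]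
          ring
      _ = (A * (Y : ℝ) ^ (-(α - 1 / 2))) ^ 2 := by
          rw [mul_pow]
          congr 1
          rw [← Real.rpow_natCast, ← Real.rpow_natCast, ← Real.rpow_mul hY0.le,
            ← Real.rpow_mul hY0.le]
          nth_rewrite 1 [← Real.rpow_one (Y : ℝ)]
          rw [← Real.rpow_add hY0]
          congr 1
          push_cast
          ring
  refine hbd.trans ?_
  gcongr
  exact le_mul_of_one_le_right hA (by linarith [Nat.cast_nonneg (α := ℝ) j])

/-- At `M = 1` the logarithm vanishes, which is the case used for structure functions; for high-pass
filters `M` grows and `log M` remains. -/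
lemma exists_normLp_four_pow_le {α : ℝ} (hα : 1 / 2 < α) : ∃ C : ℝ, 0 < C ∧
    ∀ (b : ℕ → ℂ) (A : ℝ) (M : ℕ), 0 ≤ A → 1 ≤ M → (∀ n < M, b n = 0) →
      (∀ n : ℕ, 1 ≤ n → ‖b n‖ ≤ A * (n : ℝ) ^ (-α)) → (Summable fun n => ‖b n‖) →
      normLp 4 (∑' n, quadTerm b n) ^ 4 ≤
        C * A ^ 4 * (1 + Real.log M) * ((M : ℝ) ^ (1 / 2 - α)) ^ 4 := by
  obtain ⟨C, hC, h⟩ := exists_norm_sum_le_of_dyadic_blocks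
    (Lp ℂ 4 (AddCircle.haarAddCircle : Measure UnitAddCircle)) (β := α - 1 / 2) (by linarith)
  refine ⟨C ^ 4 * 132, by positivity, fun b A M hA hM hb0 hb hs => ?_⟩
  have hM0 : (1 : ℝ) ≤ M := by exact_mod_cast hM
  have hlog : 0 ≤ Real.log M := Real.log_nonneg hM0
  -- The fourth root of the block loss; `132 = 33 · 2²` comes from `card_sqQuads_le` at `X = 2Y`.
  set L : ℝ := (132 * (1 + Real.log M)) ^ ((4 : ℕ) : ℝ)⁻¹ with hL
  have hL4 : L ^ 4 = 132 * (1 + Real.log M) :=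
    Real.rpow_inv_natCast_pow (by positivity) (by norm_num)
  have hmain : normLp 4 (∑' n, quadTerm b n) ≤ C * (A * L) * (M : ℝ) ^ (1 / 2 - α) := by
    refine normLp_tsum_le_of_range_le hM hs fun K => ?_
    rw [← neg_sub α]
    refine h _ M (A * L) (by positivity) (fun n hn => by simp [quadTerm, hb0 n hn])
      (fun j => ?_) K
    set Y := 2 ^ j * M with hY
    have hY1 : 1 ≤ Y := Nat.one_le_iff_ne_zero.2 (by positivity)
    have hY0 : (0 : ℝ) < Y := by exact_mod_cast hY1
    rw [← map_sum]
    change normLp 4 _ ≤ _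
    rw [← pow_le_pow_iff_left₀ (normLp_nonneg _ _) (by positivity) four_ne_zero]
    have hpt := norm_coeff_le_of_mem_block (by linarith) hA hY1 hb
    have hcard : ((sqQuads (Finset.Ico Y (2 * Y))).card : ℝ) ≤
        33 * ((2 * Y : ℕ) : ℝ) ^ 2 * (1 + Real.log (2 * Y : ℕ)) := by
      refine le_trans ?_ (card_sqQuads_le (X := 2 * Y) (by omega))
      have : Finset.Ico Y (2 * Y) ⊆ Finset.Icc 1 (2 * Y) := by
        intro n
        simp only [Finset.mem_Ico, Finset.mem_Icc]
        omega
      exact_mod_cast Finset.card_le_card (sqQuads_mono this)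
    have hlogY : 1 + Real.log (2 * Y : ℕ) ≤ ((j : ℝ) + 2) ^ 4 * (1 + Real.log M) := by
      have h1 : Real.log (2 * Y : ℕ) = (j + 1) * Real.log 2 + Real.log M := by
        rw [hY, ← mul_assoc, ← pow_succ']
        push_cast
        rw [Real.log_mul (by positivity) (by positivity), Real.log_pow]
        push_cast
        ring
      have h2 : (j + 1) * Real.log 2 ≤ (j : ℝ) + 1 :=
        mul_le_of_le_one_right (by positivity) (by linarith [Real.log_two_lt_d9])
      -- The logarithm is only linear in `j`; the wasteful fourth power becomes the factor `j + 2`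
      -- after taking fourth roots.
      have h3 : (j : ℝ) + 2 ≤ ((j : ℝ) + 2) ^ 4 :=
        le_self_pow₀ (by linarith [Nat.cast_nonneg (α := ℝ) j]) (by norm_num)
      calc 1 + Real.log (2 * Y : ℕ) ≤ ((j : ℝ) + 2) * (1 + Real.log M) := by
            rw [h1]; nlinarith [Nat.cast_nonneg (α := ℝ) j]
        _ ≤ _ := by gcongr
    have hpow : (Y : ℝ) ^ 2 * ((Y : ℝ) ^ (-α)) ^ 4 = ((Y : ℝ) ^ (-(α - 1 / 2))) ^ 4 := by
      rw [← Real.rpow_natCast, ← Real.rpow_natCast, ← Real.rpow_natCast, ← Real.rpow_mul hY0.le,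
        ← Real.rpow_mul hY0.le, ← Real.rpow_add hY0]
      congr 1
      push_cast
      ring
    calc normLp 4 (∑ n ∈ Finset.Ico Y (2 * Y), quadTerm b n) ^ 4
        ≤ (A * (Y : ℝ) ^ (-α)) ^ 4 * (sqQuads (Finset.Ico Y (2 * Y))).card :=
          normLp_four_pow_sum_le hpt
      _ ≤ (A * (Y : ℝ) ^ (-α)) ^ 4 *
          (33 * ((2 * Y : ℕ) : ℝ) ^ 2 * (((j : ℝ) + 2) ^ 4 * (1 + Real.log M))) := by
          gcongr
          refine hcard.trans ?_
          gcongr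
      _ = A ^ 4 * (132 * (1 + Real.log M)) * ((j : ℝ) + 2) ^ 4 *
          ((Y : ℝ) ^ 2 * ((Y : ℝ) ^ (-α)) ^ 4) := by push_cast; ring
      _ = (A * L * (j + 2) * (Y : ℝ) ^ (-(α - 1 / 2))) ^ 4 := by
          rw [hpow, ← hL4]; ring
  calc normLp 4 (∑' n, quadTerm b n) ^ 4 ≤ (C * (A * L) * (M : ℝ) ^ (1 / 2 - α)) ^ 4 :=
        pow_le_pow_left₀ (normLp_nonneg _ _) hmain 4
    _ = C ^ 4 * A ^ 4 * L ^ 4 * ((M : ℝ) ^ (1 / 2 - α)) ^ 4 := by ring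
    _ = _ := by rw [hL4]; ring

lemma sum_norm_sq_le_normLp_two_sq {b : ℕ → ℂ} (hb : Summable fun n => ‖b n‖) (S : Finset ℕ) :
    ∑ n ∈ S, ‖b n‖ ^ 2 ≤ normLp 2 (∑' n, quadTerm b n) ^ 2 := by
  obtain ⟨K₀, hK₀⟩ := S.exists_nat_subset_range
  refine ge_of_tendsto ((tendsto_normLp_sum 2 hb).pow 2) ?_
  filter_upwards [eventually_ge_atTop K₀] with K hK
  rw [normLp_two_sq_sum]
  exact Finset.sum_le_sum_of_subset_of_nonneg
    (hK₀.trans (Finset.range_mono hK)) fun n _ _ => by positivity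

lemma card_sqQuads_mul_le_normLp_four_pow {c : ℕ → ℝ} (hc : Summable c) (hc0 : ∀ n, 0 ≤ c n)
    {S : Finset ℕ} {A : ℝ} (hA : 0 ≤ A) (hS : ∀ n ∈ S, A ≤ c n) :
    A ^ 4 * (sqQuads S).card ≤ normLp 4 (∑' n, quadTerm (fun n => (c n : ℂ)) n) ^ 4 := by
  obtain ⟨K₀, hK₀⟩ := S.exists_nat_subset_range
  have hb : Summable fun n => ‖(c n : ℂ)‖ := by
    simpa only [Complex.norm_real] using hc.norm
  refine ge_of_tendsto ((tendsto_normLp_sum 4 hb).pow 4) ?_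
  filter_upwards [eventually_ge_atTop K₀] with K hK
  exact le_normLp_four_pow_sum hA (fun n _ => hc0 n) (hK₀.trans (Finset.range_mono hK)) hS

/-! ### High-pass filters and increments of `R_s` as series over squares. -/

/-- The coefficient `n^{-2s}` restricted to `n ≥ M`. -/
noncomputable def rCoeff (s : ℝ) (M n : ℕ) : ℝ := if M ≤ n then (n : ℝ) ^ (-(2 * s)) else 0

lemma rCoeff_nonneg (s : ℝ) (M n : ℕ) : 0 ≤ rCoeff s M n := by
  unfold rCoeff; split_ifs <;> positivity

lemma rCoeff_le (s : ℝ) (M n : ℕ) : rCoeff s M n ≤ (n : ℝ) ^ (-(2 * s)) := by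
  unfold rCoeff; split_ifs
  · exact le_rfl
  · positivity

lemma summable_rCoeff {s : ℝ} (hs : 1 / 2 < s) (M : ℕ) : Summable (rCoeff s M) :=
  Summable.of_nonneg_of_le (rCoeff_nonneg s M) (rCoeff_le s M)
    (Real.summable_nat_rpow.2 (by linarith))

lemma summable_norm_rCoeff {s : ℝ} (hs : 1 / 2 < s) (M : ℕ) :
    Summable fun n => ‖(rCoeff s M n : ℂ)‖ := by
  simpa only [Complex.norm_real] using (summable_rCoeff hs M).norm

lemma summable_quadTerm {b : ℕ → ℂ} (hb : Summable fun n => ‖b n‖) : Summable (quadTerm b) :=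
  Summable.of_norm (by simpa only [norm_quadTerm] using hb)

/-- The frequencies `n ≥ M` of `R_s`, as a continuous function. -/
noncomputable def riemannTail (s : ℝ) (M : ℕ) : C(UnitAddCircle, ℂ) :=
  ∑' n, quadTerm (fun n => (rCoeff s M n : ℂ)) n

lemma riemannR_eq_riemannTail {s : ℝ} (hs : 1 / 2 < s) : riemannR s = riemannTail s 1 := by
  ext x
  have hsum := summable_quadTerm (summable_norm_rCoeff hs 1)
  rw [riemannTail, ← ContinuousMap.tsum_apply hsum, (ContinuousMap.summable_apply hsum x).tsum_eq_zero_add,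
    riemannR]
  have h0 : quadTerm (fun n => (rCoeff s 1 n : ℂ)) 0 x = 0 := by simp [quadTerm_apply, rCoeff]
  rw [h0, zero_add]
  refine tsum_congr fun n => ?_
  rw [quadTerm_apply, rCoeff, if_pos (by omega), Real.rpow_neg (by positivity)]
  push_cast
  rw [div_eq_inv_mul]

lemma toLp_quadTerm (b : ℕ → ℂ) (n : ℕ) :
    ContinuousMap.toLp 2 AddCircle.haarAddCircle ℂ (quadTerm b n)
      = b n • fourierLp (T := 1) 2 ((n : ℤ) ^ 2) := by
  rw [quadTerm, map_smul]

/-- The series converges uniformly, so the continuous functional `⟨e_i, ·⟩` on `L²` may be applied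
termwise. -/
lemma hasSum_fourierCoeff_quadTerm {b : ℕ → ℂ} (hb : Summable fun n => ‖b n‖) (i : ℤ) :
    HasSum (fun n : ℕ => if (n : ℤ) ^ 2 = i then b n else 0)
      (fourierCoeff (∑' n, quadTerm b n : C(UnitAddCircle, ℂ)) i) := by
  have h1 := ((summable_quadTerm hb).hasSum.mapL
    (ContinuousMap.toLp 2 AddCircle.haarAddCircle ℂ)).mapL
      (innerSL ℂ (fourierLp (T := 1) 2 i))
  rw [← fourierCoeff_toLp, ← fourierBasis_repr, HilbertBasis.repr_apply_apply, coe_fourierBasis]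
  have h2 : (fun n : ℕ => if (n : ℤ) ^ 2 = i then b n else 0) = fun n =>
      innerSL ℂ (fourierLp (T := 1) 2 i)
        (ContinuousMap.toLp 2 AddCircle.haarAddCircle ℂ (quadTerm b n)) := by
    funext n
    have ho := orthonormal_iff_ite.1 (orthonormal_fourier (T := 1)) i ((n : ℤ) ^ 2)
    rw [toLp_quadTerm, innerSL_apply_apply, inner_smul_right, ho]
    simp [eq_comm]
  rw [h2]
  exact h1

lemma fourierCoeff_quadSeries_sq {b : ℕ → ℂ} (hb : Summable fun n => ‖b n‖) (k : ℕ) :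
    fourierCoeff (∑' n, quadTerm b n : C(UnitAddCircle, ℂ)) ((k : ℤ) ^ 2) = b k := by
  refine (hasSum_fourierCoeff_quadTerm hb _).unique ?_
  convert hasSum_ite_eq k (b k) using 2 with n
  by_cases h : n = k
  · rw [h, if_pos rfl, if_pos rfl]
  · rw [if_neg h, if_neg fun h' => h (natCast_sq_injective h')]

lemma fourierCoeff_quadSeries_of_not_sq {b : ℕ → ℂ} (hb : Summable fun n => ‖b n‖) {i : ℤ}
    (hi : ∀ k : ℕ, (k : ℤ) ^ 2 ≠ i) :
    fourierCoeff (∑' n, quadTerm b n : C(UnitAddCircle, ℂ)) i = 0 := by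
  refine (hasSum_fourierCoeff_quadTerm hb _).unique ?_
  simp only [hi, if_false]
  exact hasSum_zero

/-- Only frequencies `k²` carry coefficients, so the sum over `|n| ≥ N` reindexes to `k² ≥ N`, that
is `k ≥ M`. -/
lemma highPass_quadSeries {b : ℕ → ℂ} (hb : Summable fun n => ‖b n‖) {N M : ℕ}
    (hM : ∀ k : ℕ, N ≤ k ^ 2 ↔ M ≤ k) :
    highPass (∑' n, quadTerm b n : C(UnitAddCircle, ℂ)) N =
      ContinuousMap.toLp 2 AddCircle.haarAddCircle ℂ
        (∑' n, quadTerm (fun n => if M ≤ n then b n else 0) n) := by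
  have hb' : Summable fun n => ‖if M ≤ n then b n else 0‖ := by
    refine Summable.of_nonneg_of_le (fun n => norm_nonneg _) (fun n => ?_) hb
    split_ifs <;> simp
  let g : {k : ℕ | N ≤ k ^ 2} → {n : ℤ // (N : ℤ) ≤ |n|} := fun k =>
    ⟨(k : ℤ) ^ 2, by
      have := k.2
      rw [Set.mem_ofPred_eq] at this
      rw [abs_of_nonneg (by positivity)]
      exact_mod_cast this⟩
  have hg : Function.Injective g := fun k l h =>
    Subtype.ext (natCast_sq_injective (congrArg Subtype.val h))
  rw [((ContinuousMap.toLp 2 AddCircle.haarAddCircle ℂ)).map_tsum (summable_quadTerm hb')]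
  rw [highPass, ← hg.tsum_eq]
  · have h1 : ∀ k : {k : ℕ | N ≤ k ^ 2},
        fourierCoeff (∑' n, quadTerm b n : C(UnitAddCircle, ℂ)) (g k : ℤ) • fourierLp 2 (g k : ℤ) =
          (fun k : ℕ => b k • fourierLp (T := 1) 2 ((k : ℤ) ^ 2)) k := by
      intro k
      simp only [g, fourierCoeff_quadSeries_sq hb]
    simp_rw [h1]
    rw [tsum_subtype {k : ℕ | N ≤ k ^ 2}
      (fun k : ℕ => b k • fourierLp (T := 1) 2 ((k : ℤ) ^ 2))]
    refine tsum_congr fun k => ?_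
    rw [toLp_quadTerm]
    by_cases hk : M ≤ k
    · rw [Set.indicator_of_mem (by simpa [hM] using hk), if_pos hk]
    · rw [Set.indicator_of_notMem (by simpa [hM] using hk), if_neg hk, zero_smul]
  · rintro ⟨n, hn⟩ hne
    rw [Function.mem_support] at hne
    by_contra hcon
    apply hne
    have : fourierCoeff (∑' n, quadTerm b n : C(UnitAddCircle, ℂ)) n = 0 := by
      refine fourierCoeff_quadSeries_of_not_sq hb fun k hk => hcon ⟨⟨k, ?_⟩, Subtype.ext hk⟩
      rw [Set.mem_ofPred_eq]
      rw [← hk, abs_of_nonneg (by positivity)] at hn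
      exact_mod_cast hn
    simp only [this, zero_smul]

lemma flatnessHP_riemannR {s : ℝ} (hs : 1 / 2 < s) {N M : ℕ} (hM1 : 1 ≤ M)
    (hM : ∀ k : ℕ, N ≤ k ^ 2 ↔ M ≤ k) :
    flatnessHP (riemannR s) 4 N =
      normLp 4 (riemannTail s M) ^ 4 / normLp 2 (riemannTail s M) ^ 4 := by
  have h : highPass (riemannR s) N =
      ContinuousMap.toLp 2 AddCircle.haarAddCircle ℂ (riemannTail s M) := by
    rw [riemannR_eq_riemannTail hs, riemannTail,
      highPass_quadSeries (summable_norm_rCoeff hs 1) hM, riemannTail]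
    congr 3
    ext n
    rw [quadTerm, quadTerm]
    congr 1
    simp only [rCoeff]
    split_ifs <;> first | rfl | omega
  rw [flatnessHP, h, eLpNorm_congr_ae (ContinuousMap.coeFn_toLp _ (riemannTail s M)),
    eLpNorm_congr_ae (ContinuousMap.coeFn_toLp _ (riemannTail s M)),
    show ENNReal.ofReal 4 = 4 by simp, ← normLp_eq_toReal_eLpNorm, ← normLp_eq_toReal_eLpNorm]
  norm_cast

lemma summable_norm_rCoeff_mul {s : ℝ} (hs : 1 / 2 < s) (ℓ : ℝ) : Summable fun n : ℕ =>
    ‖(rCoeff s 1 n : ℂ) * (fourier ((n : ℤ) ^ 2) (ℓ : UnitAddCircle) - 1)‖ := by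
  refine Summable.of_nonneg_of_le (fun n => norm_nonneg _) (fun n => ?_)
    ((summable_norm_rCoeff hs 1).mul_right 2)
  rw [norm_mul]
  gcongr
  refine (norm_sub_le _ _).trans ?_
  rw [fourier_apply, Circle.norm_coe, norm_one]
  norm_num

lemma structureFunction_riemannR {s : ℝ} (hs : 1 / 2 < s) (ℓ : ℝ) (k : ℕ) (hk : k ≠ 0)
    (p : ENNReal) [Fact (1 ≤ p)] (hp : p = k) :
    structureFunction (riemannR s) k ℓ = normLp p (∑' n, quadTerm (fun n : ℕ =>
      (rCoeff s 1 n : ℂ) * (fourier ((n : ℤ) ^ 2) (ℓ : UnitAddCircle) - 1)) n) ^ k := by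
  have hsum := summable_quadTerm (summable_norm_rCoeff hs 1)
  have hb := summable_norm_rCoeff_mul hs ℓ
  have hsum' := summable_quadTerm hb
  rw [normLp_pow_eq_integral p k hk hp, structureFunction]
  refine integral_congr_ae (Eventually.of_forall fun x => ?_)
  dsimp only
  rw [Real.rpow_natCast, riemannR_eq_riemannTail hs, riemannTail,
    ← ContinuousMap.tsum_apply hsum, ← ContinuousMap.tsum_apply hsum, ← ContinuousMap.tsum_apply hsum',
    ← (ContinuousMap.summable_apply hsum _).tsum_sub (ContinuousMap.summable_apply hsum _)]
  congr 2
  refine tsum_congr fun n => ?_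
  simp only [quadTerm_apply, fourier_apply, smul_add, AddCircle.toCircle_add, Circle.coe_mul]
  ring

/-! ### High-pass flatness of `R_s`. -/

lemma rpow_half_sub_pow {x : ℝ} (hx : 0 < x) (α : ℝ) (k : ℕ) :
    (x ^ (1 / 2 - α)) ^ (2 * k) = x ^ k * (x ^ (-α)) ^ (2 * k) := by
  rw [← Real.rpow_natCast, ← Real.rpow_natCast, ← Real.rpow_natCast, ← Real.rpow_mul hx.le,
    ← Real.rpow_mul hx.le, ← Real.rpow_add hx]
  congr 1
  push_cast
  ring

lemma le_rCoeff {s : ℝ} (hs : 0 ≤ s) {M n k : ℕ} (hM : 1 ≤ M) (hn : M ≤ n) (hn' : n ≤ k * M) :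
    (k : ℝ) ^ (-(2 * s)) * (M : ℝ) ^ (-(2 * s)) ≤ rCoeff s M n := by
  rw [rCoeff, if_pos hn, ← Real.mul_rpow (by positivity) (by positivity)]
  exact Real.rpow_le_rpow_of_nonpos (by exact_mod_cast hM.trans hn) (by exact_mod_cast hn')
    (by linarith)

lemma le_normLp_two_riemannTail {s : ℝ} (hs : 1 / 2 < s) {M : ℕ} (hM : 1 ≤ M) :
    (2 : ℝ) ^ (-(2 * s)) * (M : ℝ) ^ (1 / 2 - 2 * s) ≤ normLp 2 (riemannTail s M) := by
  have hM0 : (0 : ℝ) < M := by exact_mod_cast hM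
  rw [← pow_le_pow_iff_left₀ (by positivity) (normLp_nonneg _ _) two_ne_zero]
  refine le_trans ?_ (sum_norm_sq_le_normLp_two_sq (summable_norm_rCoeff hs M)
    (Finset.Ico M (2 * M)))
  calc ((2 : ℝ) ^ (-(2 * s)) * (M : ℝ) ^ (1 / 2 - 2 * s)) ^ 2
      = M * ((2 : ℝ) ^ (-(2 * s)) * (M : ℝ) ^ (-(2 * s))) ^ 2 := by
        have := rpow_half_sub_pow hM0 (2 * s) 1
        rw [mul_one, pow_one] at this
        rw [mul_pow, mul_pow, this]
        ring
    _ = ∑ n ∈ Finset.Ico M (2 * M), ((2 : ℝ) ^ (-(2 * s)) * (M : ℝ) ^ (-(2 * s))) ^ 2 := by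
        rw [Finset.sum_const, Nat.card_Ico, nsmul_eq_mul, show 2 * M - M = M by omega]
    _ ≤ _ := by
        refine Finset.sum_le_sum fun n hn => ?_
        rw [Finset.mem_Ico] at hn
        rw [Complex.norm_real, Real.norm_of_nonneg (rCoeff_nonneg s M n)]
        have := le_rCoeff (k := 2) (by linarith : 0 ≤ s) hM hn.1 hn.2.le
        gcongr
        exact_mod_cast this

lemma le_normLp_four_pow_riemannTail {s : ℝ} (hs : 1 / 2 < s) {M : ℕ} (hM : 1 ≤ M) :
    ((9 : ℝ) ^ (-(2 * s))) ^ 4 / 32 * Real.log M * ((M : ℝ) ^ (1 / 2 - 2 * s)) ^ 4 ≤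
      normLp 4 (riemannTail s M) ^ 4 := by
  have hM0 : (0 : ℝ) < M := by exact_mod_cast hM
  have h := card_sqQuads_mul_le_normLp_four_pow (summable_rCoeff hs M) (rCoeff_nonneg s M)
    (S := Finset.Icc M (9 * M)) (A := (9 : ℝ) ^ (-(2 * s)) * (M : ℝ) ^ (-(2 * s)))
    (by positivity) fun n hn => by
      rw [Finset.mem_Icc] at hn
      exact_mod_cast le_rCoeff (k := 9) (by linarith : 0 ≤ s) hM hn.1 hn.2
  refine le_trans ?_ h
  have hcard := le_card_sqQuads hM
  calc _ = ((9 : ℝ) ^ (-(2 * s)) * (M : ℝ) ^ (-(2 * s))) ^ 4 * ((M : ℝ) ^ 2 * Real.log M / 32) := by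
        rw [rpow_half_sub_pow hM0 (2 * s) 2]
        ring
    _ ≤ _ := by gcongr

lemma norm_rCoeff_le (s : ℝ) (M n : ℕ) :
    ‖(rCoeff s M n : ℂ)‖ ≤ 1 * (n : ℝ) ^ (-(2 * s)) := by
  rw [Complex.norm_real, Real.norm_of_nonneg (rCoeff_nonneg s M n), one_mul]
  exact rCoeff_le s M n

lemma rCoeff_of_lt (s : ℝ) {M n : ℕ} (h : n < M) : rCoeff s M n = 0 := if_neg (by omega)

lemma exists_flatness_riemannTail_bounds {s : ℝ} (hs : 1 / 2 < s) : ∃ c C : ℝ, 0 < c ∧ 0 < C ∧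
    ∀ M : ℕ, 1 ≤ M →
      c * Real.log M ≤ normLp 4 (riemannTail s M) ^ 4 / normLp 2 (riemannTail s M) ^ 4 ∧
      normLp 4 (riemannTail s M) ^ 4 / normLp 2 (riemannTail s M) ^ 4 ≤ C * (1 + Real.log M) := by
  obtain ⟨C₂, hC₂, h₂⟩ := exists_normLp_two_le (α := 2 * s) (by linarith)
  obtain ⟨C₄, hC₄, h₄⟩ := exists_normLp_four_pow_le (α := 2 * s) (by linarith)
  refine ⟨((9 : ℝ) ^ (-(2 * s))) ^ 4 / 32 / C₂ ^ 4, C₄ / ((2 : ℝ) ^ (-(2 * s))) ^ 4,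
    by positivity, by positivity, fun M hM => ?_⟩
  have hM0 : (1 : ℝ) ≤ M := by exact_mod_cast hM
  have hlog : 0 ≤ Real.log M := Real.log_nonneg hM0
  have hzero : ∀ n < M, (rCoeff s M n : ℂ) = 0 := fun n hn => by
    rw [rCoeff_of_lt s hn, Complex.ofReal_zero]
  have u2 := h₂ _ 1 M zero_le_one hM hzero (fun n _ => norm_rCoeff_le s M n)
    (summable_norm_rCoeff hs M)
  have u4 := h₄ _ 1 M zero_le_one hM hzero (fun n _ => norm_rCoeff_le s M n)
    (summable_norm_rCoeff hs M)
  have l2 := le_normLp_two_riemannTail hs hM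
  have l4 := le_normLp_four_pow_riemannTail hs hM
  change normLp 2 (riemannTail s M) ≤ _ at u2
  change normLp 4 (riemannTail s M) ^ 4 ≤ _ at u4
  set X := (M : ℝ) ^ (1 / 2 - 2 * s) with hX
  have hX0 : 0 < X := by positivity
  have hp : 0 < normLp 2 (riemannTail s M) := lt_of_lt_of_le (by positivity) l2
  constructor
  · rw [le_div_iff₀ (by positivity)]
    calc _ ≤ ((9 : ℝ) ^ (-(2 * s))) ^ 4 / 32 / C₂ ^ 4 * Real.log M * (C₂ * 1 * X) ^ 4 := by gcongr
      _ = ((9 : ℝ) ^ (-(2 * s))) ^ 4 / 32 * Real.log M * X ^ 4 := by field_simp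
      _ ≤ _ := l4
  · rw [div_le_iff₀ (by positivity)]
    calc _ ≤ C₄ * 1 ^ 4 * (1 + Real.log M) * X ^ 4 := u4
      _ = C₄ / ((2 : ℝ) ^ (-(2 * s))) ^ 4 * (1 + Real.log M) * ((2 : ℝ) ^ (-(2 * s)) * X) ^ 4 := by
        field_simp
      _ ≤ _ := by gcongr

lemma flatnessHP_riemannR_isTheta {s : ℝ} (hs : 1 / 2 < s) :
    (fun N : ℕ => flatnessHP (riemannR s) 4 N) =Θ[atTop] fun N : ℕ => Real.log N := by
  obtain ⟨c, C, hc, hC, h⟩ := exists_flatness_riemannTail_bounds hs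
  have key : ∀ N : ℕ, 3 ≤ N → c / 2 * Real.log N ≤ flatnessHP (riemannR s) 4 N ∧
      flatnessHP (riemannR s) 4 N ≤ 2 * C * Real.log N ∧ 0 ≤ Real.log N := by
    intro N hN
    -- Then `M ≤ N ≤ M²`, so `log M` and `log N` agree up to a factor `2`.
    set M := ⌈Real.sqrt N⌉₊ with hMdef
    have hN0 : (3 : ℝ) ≤ N := by exact_mod_cast hN
    have hM : ∀ k : ℕ, N ≤ k ^ 2 ↔ M ≤ k := by
      intro k
      rw [hMdef, Nat.ceil_le, Real.sqrt_le_left (by positivity)]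
      exact_mod_cast Iff.rfl
    have hM1 : 1 ≤ M := Nat.one_le_ceil_iff.2 (by positivity)
    have hMN : M ≤ N := (hM N).1 (by nlinarith)
    have hNM : N ≤ M ^ 2 := (hM M).2 le_rfl
    have hM0 : (0 : ℝ) < M := by exact_mod_cast hM1
    have hlog1 : Real.log M ≤ Real.log N := Real.log_le_log hM0 (by exact_mod_cast hMN)
    have hlog2 : Real.log N ≤ 2 * Real.log M := by
      rw [← Nat.cast_ofNat (R := ℝ) (n := 2), ← Real.log_pow]
      exact Real.log_le_log (by linarith) (by exact_mod_cast hNM)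
    -- `N ≥ 3 > e` lets `log N` absorb the additive `1` in the upper bound.
    have hlog3 : 1 ≤ Real.log N := by
      rw [Real.le_log_iff_exp_le (by linarith)]
      linarith [Real.exp_one_lt_d9]
    obtain ⟨h1, h2⟩ := h M hM1
    rw [flatnessHP_riemannR hs hM1 hM]
    refine ⟨le_trans ?_ h1, h2.trans ?_, by linarith⟩
    · nlinarith
    · nlinarith
  constructor
  · refine IsBigO.of_bound (2 * C) ?_
    filter_upwards [eventually_ge_atTop 3] with N hN
    obtain ⟨h1, h2, h3⟩ := key N hN
    rw [Real.norm_of_nonneg h3, Real.norm_of_nonneg (le_trans (by positivity) h1)]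
    exact h2
  · refine IsBigO.of_bound (c / 2)⁻¹ ?_
    filter_upwards [eventually_ge_atTop 3] with N hN
    obtain ⟨h1, h2, h3⟩ := key N hN
    rw [Real.norm_of_nonneg h3, Real.norm_of_nonneg (le_trans (by positivity) h1),
      le_inv_mul_iff₀ (by positivity)]
    exact h1

/-! ### Structure-function flatness of `R_s`. -/

lemma norm_fourier_coe_sub_one (m : ℤ) (ℓ : ℝ) :
    ‖(fourier m (ℓ : UnitAddCircle) : ℂ) - 1‖ = ‖2 * Real.sin (Real.pi * m * ℓ)‖ := by
  have h := Complex.norm_exp_I_mul_ofReal_sub_one (2 * Real.pi * m * ℓ)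
  rw [fourier_coe_apply]
  rw [show 2 * Real.pi * m * ℓ / 2 = Real.pi * m * ℓ by ring] at h
  rw [← h]
  congr 3
  push_cast
  ring

lemma flatnessSF_riemannR_isTheta {s : ℝ} (hs : 5 / 4 < s) :
    (fun ℓ : ℝ => flatnessSF (riemannR s) 4 ℓ) =Θ[𝓝[>] 0] fun _ => (1 : ℝ) := by
  -- The increment costs a factor `n²`, so the decay exponent drops from `2s` to `2s - 2`; it
  -- exceeds `1/2` exactly when `s > 5/4`.
  obtain ⟨C, hC, h⟩ := exists_normLp_four_pow_le (α := 2 * s - 2) (by linarith)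
  have key : ∀ ℓ : ℝ, 0 < ℓ → ℓ < 1 / 2 → 1 ≤ flatnessSF (riemannR s) 4 ℓ ∧
      flatnessSF (riemannR s) 4 ℓ ≤ C * (2 * Real.pi) ^ 4 / 4 ^ 4 := by
    intro ℓ hℓ hℓ'
    set b : ℕ → ℂ := fun n =>
      (rCoeff s 1 n : ℂ) * (fourier ((n : ℤ) ^ 2) (ℓ : UnitAddCircle) - 1) with hb
    have hbs : Summable fun n => ‖b n‖ := summable_norm_rCoeff_mul (by linarith) ℓ
    have hG : flatnessSF (riemannR s) 4 ℓ =
        normLp 4 (∑' n, quadTerm b n) ^ 4 / normLp 2 (∑' n, quadTerm b n) ^ 4 := by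
      have e4 := structureFunction_riemannR (by linarith : 1 / 2 < s) ℓ 4 (by norm_num) 4
        (by norm_num)
      have e2 := structureFunction_riemannR (by linarith : 1 / 2 < s) ℓ 2 (by norm_num) 2
        (by norm_num)
      rw [Nat.cast_ofNat] at e4 e2
      rw [flatnessSF, e4, e2, show (4 / 2 : ℝ) = ((2 : ℕ) : ℝ) by norm_num, Real.rpow_natCast,
        ← pow_mul]
    have hbound : ∀ n : ℕ, 1 ≤ n → ‖b n‖ ≤ (2 * Real.pi * ℓ) * (n : ℝ) ^ (-(2 * s - 2)) := by
      intro n hn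
      have hn0 : (0 : ℝ) < n := by exact_mod_cast hn
      rw [hb, norm_mul, norm_fourier_coe_sub_one, norm_mul, Real.norm_two]
      have h1 : ‖Real.sin (Real.pi * ((n : ℤ) ^ 2 : ℤ) * ℓ)‖ ≤ Real.pi * (n : ℝ) ^ 2 * ℓ := by
        rw [Real.norm_eq_abs]
        refine Real.abs_sin_le_abs.trans ?_
        rw [abs_of_nonneg (by positivity)]
        push_cast
        exact le_rfl
      have h2 : (n : ℝ) ^ (-(2 * s)) * (n : ℝ) ^ 2 = (n : ℝ) ^ (-(2 * s - 2)) := by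
        rw [← Real.rpow_natCast (n : ℝ) 2, ← Real.rpow_add hn0]
        congr 1
        push_cast
        ring
      calc _ ≤ (1 * (n : ℝ) ^ (-(2 * s))) * (2 * (Real.pi * (n : ℝ) ^ 2 * ℓ)) := by
            gcongr
            exact norm_rCoeff_le s 1 n
        _ = _ := by rw [← h2]; ring
    have u4 := h b (2 * Real.pi * ℓ) 1 (by positivity) le_rfl (fun n hn => by
      rw [hb]; dsimp only; rw [rCoeff_of_lt s hn, Complex.ofReal_zero, zero_mul]) hbound hbs
    rw [Nat.cast_one, Real.log_one, Real.one_rpow, one_pow, add_zero, mul_one, mul_one] at u4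
    -- The frequency `n = 1` suffices: `|b_1| = 2 sin(πℓ) ≥ 4ℓ` by Jordan's inequality, valid as `ℓ
    -- < 1/2`.
    have l2 : 4 * ℓ ≤ normLp 2 (∑' n, quadTerm b n) := by
      rw [← pow_le_pow_iff_left₀ (by positivity) (normLp_nonneg _ _) two_ne_zero]
      refine le_trans ?_ (sum_norm_sq_le_normLp_two_sq hbs {1})
      rw [Finset.sum_singleton]
      have hsin : 2 * ℓ ≤ Real.sin (Real.pi * ℓ) := by
        have := Real.mul_le_sin (x := Real.pi * ℓ) (by positivity) (by nlinarith [Real.pi_pos])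
        calc 2 * ℓ = 2 / Real.pi * (Real.pi * ℓ) := by field_simp
          _ ≤ _ := this
      have hb1 : ‖b 1‖ = 2 * Real.sin (Real.pi * ℓ) := by
        rw [hb, norm_mul, norm_fourier_coe_sub_one]
        simp [rCoeff]
        linarith
      rw [hb1]
      exact pow_le_pow_left₀ (by positivity) (by linarith) 2
    -- On a probability space `‖·‖₂ ≤ ‖·‖₄`, whence `G ≥ 1`.
    have h24 := normLp_two_le_four (∑' n, quadTerm b n)
    have hp : 0 < normLp 2 (∑' n, quadTerm b n) := lt_of_lt_of_le (by positivity) l2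
    rw [hG]
    constructor
    · rw [one_le_div (by positivity)]
      gcongr
    · rw [div_le_iff₀ (by positivity)]
      calc _ ≤ C * (2 * Real.pi * ℓ) ^ 4 := u4
        _ = C * (2 * Real.pi) ^ 4 / 4 ^ 4 * (4 * ℓ) ^ 4 := by ring
        _ ≤ _ := by gcongr
  have hev : ∀ᶠ ℓ : ℝ in 𝓝[>] 0, 0 < ℓ ∧ ℓ < 1 / 2 :=
    Ioo_mem_nhdsGT (by norm_num : (0 : ℝ) < 1 / 2)
  constructor
  · refine IsBigO.of_bound (C * (2 * Real.pi) ^ 4 / 4 ^ 4) ?_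
    filter_upwards [hev] with ℓ hℓ
    obtain ⟨h1, h2⟩ := key ℓ hℓ.1 hℓ.2
    rw [norm_one, mul_one, Real.norm_of_nonneg (by linarith)]
    exact h2
  · refine IsBigO.of_bound 1 ?_
    filter_upwards [hev] with ℓ hℓ
    obtain ⟨h1, h2⟩ := key ℓ hℓ.1 hℓ.2
    rw [norm_one, one_mul, Real.norm_of_nonneg (by linarith)]
    exact h1

/-! ### Non-equivalence of the two flatnesses. -/

lemma continuous_riemannR {s : ℝ} (hs : 1 / 2 < s) : Continuous (riemannR s) := by
  rw [riemannR_eq_riemannTail hs]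
  exact map_continuous _

lemma infinite_fourierCoeff_riemannR_ne_zero {s : ℝ} (hs : 1 / 2 < s) :
    {n : ℤ | fourierCoeff (riemannR s) n ≠ 0}.Infinite := by
  refine Set.infinite_of_injective_forall_mem (f := fun k : ℕ => ((k + 1 : ℕ) : ℤ) ^ 2)
    (fun k l h => Nat.succ_injective (natCast_sq_injective h)) fun k => ?_
  rw [Set.mem_ofPred_eq, riemannR_eq_riemannTail hs, riemannTail,
    fourierCoeff_quadSeries_sq (summable_norm_rCoeff hs 1), Complex.ofReal_ne_zero, rCoeff,
    if_pos (by omega)]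
  positivity

/-- Since `ℓ_N → 0⁺`, `G(ℓ_N)` stays bounded, so equivalence would bound `log N`. -/
lemma not_flatnessHP_riemannR_isTheta_flatnessSF {s : ℝ} (hs : 5 / 4 < s) {ℓ : ℕ → ℝ}
    (hpos : ∀ᶠ N in atTop, 0 < ℓ N) (hℓ : ℓ =Θ[atTop] fun N : ℕ => 1 / (N : ℝ)) :
    ¬ (fun N : ℕ => flatnessHP (riemannR s) 4 N) =Θ[atTop]
        (fun N : ℕ => flatnessSF (riemannR s) 4 (ℓ N)) := by
  intro h
  have hℓ0 : Tendsto ℓ atTop (𝓝[>] 0) :=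
    tendsto_nhdsWithin_iff.2
      ⟨hℓ.1.trans_tendsto tendsto_one_div_atTop_nhds_zero_nat, hpos⟩
  have h1 : (fun N : ℕ => Real.log N) =O[atTop] fun _ : ℕ => (1 : ℝ) :=
    (flatnessHP_riemannR_isTheta (by linarith)).2.trans
      (h.1.trans ((flatnessSF_riemannR_isTheta hs).1.comp_tendsto hℓ0))
  have h2 : Tendsto (fun N : ℕ => Real.log N) atTop atTop :=
    Real.tendsto_log_atTop.comp tendsto_natCast_atTop_atTop
  exact not_isBoundedUnder_of_tendsto_atTop (tendsto_norm_atTop_atTop.comp h2)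
    ((isBigO_one_iff ℝ).1 h1)

theorem corollaryC :
    (∀ s : ℝ, 5 / 4 < s →
      Continuous (riemannR s) ∧
      {n : ℤ | fourierCoeff (riemannR s) n ≠ 0}.Infinite ∧
      (fun ℓ : ℝ => flatnessSF (riemannR s) 4 ℓ) =Θ[𝓝[>] 0] (fun _ => (1 : ℝ)) ∧
      (fun N : ℕ => flatnessHP (riemannR s) 4 N) =Θ[atTop] (fun N : ℕ => Real.log N) ∧
      ∀ ℓ : ℕ → ℝ, (∀ᶠ N in atTop, 0 < ℓ N) → ℓ =Θ[atTop] (fun N : ℕ => 1 / (N : ℝ)) →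
        ¬ (fun N : ℕ => flatnessHP (riemannR s) 4 N) =Θ[atTop]
            (fun N : ℕ => flatnessSF (riemannR s) 4 (ℓ N))) ∧
    ¬ ∀ f : UnitAddCircle → ℂ, Continuous f → {n : ℤ | fourierCoeff f n ≠ 0}.Infinite →
        (fun N : ℕ => flatnessHP f 4 N) =Θ[atTop]
          (fun N : ℕ => flatnessSF f 4 (1 / (N : ℝ))) := by
  refine ⟨fun s hs => ⟨continuous_riemannR (by linarith),
    infinite_fourierCoeff_riemannR_ne_zero (by linarith), flatnessSF_riemannR_isTheta hs,
    flatnessHP_riemannR_isTheta (by linarith),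
    fun ℓ hpos hℓ => not_flatnessHP_riemannR_isTheta_flatnessSF hs hpos hℓ⟩, fun h => ?_⟩
  refine not_flatnessHP_riemannR_isTheta_flatnessSF (s := 2) (by norm_num) ?_ (isTheta_refl _ _)
    (h _ (continuous_riemannR (by norm_num)) (infinite_fourierCoeff_riemannR_ne_zero (by norm_num)))
  filter_upwards [eventually_gt_atTop 0] with N hN
  positivity
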